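/- **Theorem 4.5.** Let $M$ be a smooth Hausdorff manifold of real dimension $2n$ (without boundary) with an almost Kähler structure $(g,J,\kappa)$: $\kappa$ is a symplectic form (a smooth, closed, non-degenerate 2-form), $J$ is an almost complex structure (a smooth field of endomorphisms of $TM$ with $J^2=-\mathrm{Id}$), and $g(X,Y)=\kappa(X,JY)$ is a smooth Riemannian metric. Let $\nabla$ be the Levi-Civita connection of $g$, let $\widetilde\nabla=\nabla-\tfrac12 J\nabla J$ be the Hermitian connection, i.e. $\widetilde\nabla_XY=\nabla_XY-\tfrac12 J\big((\nabla_XJ)Y\big)$, and let $R$, $\widetilde R$ be their curvature tensors, $$R(X,Y,Z,W)=g(\nabla_X\nabla_YZ-\nabla_Y\nabla_XZ-\nabla_{[X,Y]}Z,\,W),$$ and likewise for $\widetilde R$ with $\widetilde\nabla$ in place of $\nabla$; both are extended complex-multilinearly to $TM\otimes\mathbb C$. A complex vector field $Z$ is of type $(1,0)$ if $JZ=iZ$. Consider the conditions (a) $\widetilde R(Z,\overline Z,W,\overline W)=R(Z,\overline Z,W,\overline W)$ for all smooth complex vector fields $Z,W$ of type $(1,0)$; (b) $\widetilde R(X,JX,Y,JY)=R(X,JX,Y,JY)$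 for all smooth real vector fields $X,Y$. Then (a) and (b) are equivalent, and if (a) holds then $(M,g,J,\kappa)$ is a Kähler manifold, that is, $J$ is integrable: the Nijenhuis tensor $$N_J(X,Y)=[JX,JY]-J[JX,Y]-J[X,JY]-[X,Y]$$ vanishes for all smooth vector fields $X,Y$. -/

import Mathlib

open Bundle VectorField
open scoped Manifold ContDiff

set_option linter.unusedSectionVars false

noncomputable section

namespace AlmostKahler

section Connections

variable {E : Type*} [NormedAddCommGroup E] [NormedSpace ℝ E]
  [FiniteDimensional ℝ E] [CompleteSpace E]
  {H : Type*} [TopologicalSpace H] {I : ModelWithCorners ℝ E H}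
  {M : Type*} [TopologicalSpace M] [ChartedSpace H M] [IsManifold I ∞ M]

/-- A smooth Riemannian metric on `M`. -/
abbrev Metric (I : ModelWithCorners ℝ E H) (M : Type*) [TopologicalSpace M] [ChartedSpace H M]
    [IsManifold I ∞ M] :=
  ContMDiffRiemannianMetric I ∞ E (fun x : M ↦ TangentSpace I x)

/-- The right-hand side of the Koszul formula for `g(∇_X Y, Z)`, at the point `x`. -/
def koszul (g : Metric I M) (X Y Z : Π x : M, TangentSpace I x) (x : M) : ℝ :=
  (1 / 2) *
    (d% (fun y ↦ g.inner y (Y y) (Z y)) x (X x)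
      + d% (fun y ↦ g.inner y (X y) (Z y)) x (Y x)
      - d% (fun y ↦ g.inner y (X y) (Y y)) x (Z x)
      + g.inner x (mlieBracket I X Y x) (Z x)
      - g.inner x (mlieBracket I X Z x) (Y x)
      - g.inner x (mlieBracket I Y Z x) (X x))

lemma mdiff_inner (g : Metric I M) {X Y : Π x : M, TangentSpace I x} {x : M}
    (hX : MDiffAt (T% X) x) (hY : MDiffAt (T% Y) x) :
    MDiffAt (fun y ↦ g.inner y (X y) (Y y)) x := by
  have h : MDifferentiableAt I (I.prod 𝓘(ℝ, ℝ))
      (fun m ↦ TotalSpace.mk' ℝ (E := Bundle.Trivial M ℝ) m (g.inner m (X m) (Y m))) x := by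
    apply MDifferentiableAt.clm_bundle_apply₂ (F₁ := E) (F₂ := E)
      (E₁ := fun x : M ↦ TangentSpace I x) (E₂ := fun x : M ↦ TangentSpace I x)
    · exact g.contMDiff.mdifferentiableAt (by simp)
    · exact hX
    · exact hY
  simp only [mdifferentiableAt_totalSpace] at h
  exact h.2

/-- The Koszul expression is tensorial in `X`. -/
lemma koszul_tensorial_left (g : Metric I M) {x : M} {Y Z : Π x : M, TangentSpace I x}
    (hY : MDiffAt (T% Y) x) (hZ : MDiffAt (T% Z) x) :
    TensorialAt I E (fun X ↦ koszul g X Y Z x) x where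
  smul {f X} hf hX := by
    have h1 := mvfderiv_fun_mul hf (mdiff_inner g hX hZ)
    have h2 := mvfderiv_fun_mul hf (mdiff_inner g hX hY)
    simp [koszul, h1, h2, mlieBracket_smul_left hf hX]
    rw [g.symm x (X x) (Y x), g.symm x (mlieBracket I X Z x)]
    ring
  add {X X'} hX hX' := by
    have h1 := mvfderiv_fun_add (mdiff_inner g hX hZ) (mdiff_inner g hX' hZ)
    have h2 := mvfderiv_fun_add (mdiff_inner g hX hY) (mdiff_inner g hX' hY)
    simp [koszul, h1, h2, mlieBracket_add_left hX hX']
    ring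

/-- The Koszul expression is tensorial in `Z`. -/
lemma koszul_tensorial_right (g : Metric I M) {x : M} {X Y : Π x : M, TangentSpace I x}
    (hX : MDiffAt (T% X) x) (hY : MDiffAt (T% Y) x) :
    TensorialAt I E (fun Z ↦ koszul g X Y Z x) x where
  smul {f Z} hf hZ := by
    have h1 := mvfderiv_fun_mul hf (mdiff_inner g hX hZ)
    have h2 := mvfderiv_fun_mul hf (mdiff_inner g hY hZ)
    simp [koszul, h1, h2, mlieBracket_smul_right hf hZ]
    rw [g.symm x (Z x) (X x), g.symm x (Z x) (Y x)]
    ring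
  add {Z Z'} hZ hZ' := by
    have h1 := mvfderiv_fun_add (mdiff_inner g hX hZ) (mdiff_inner g hX hZ')
    have h2 := mvfderiv_fun_add (mdiff_inner g hY hZ) (mdiff_inner g hY hZ')
    simp [koszul, h1, h2, mlieBracket_add_right hZ hZ']
    ring

/-- Lowering an index with the metric, as a linear equivalence between a tangent space and its
dual. -/
def flat (g : Metric I M) (x : M) : TangentSpace I x ≃ₗ[ℝ] (TangentSpace I x →L[ℝ] ℝ) :=
  haveI : FiniteDimensional ℝ (TangentSpace I x) := inferInstanceAs (FiniteDimensional ℝ E)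
  haveI : T2Space (TangentSpace I x) := inferInstanceAs (T2Space E)
  LinearEquiv.ofInjectiveOfFinrankEq (g.inner x).toLinearMap
    (by
      rw [← LinearMap.ker_eq_bot, LinearMap.ker_eq_bot']
      intro v hv
      by_contra h
      have h1 := g.pos x v h
      have h2 : g.inner x v v = 0 := by
        have := congrArg (fun f : TangentSpace I x →L[ℝ] ℝ ↦ f v) hv
        simpa using this
      exact h1.ne' h2)
    (by
      rw [← (LinearMap.toContinuousLinearMap
        (𝕜 := ℝ) (E := TangentSpace I x) (F' := ℝ)).finrank_eq]
      exact Subspace.dual_finrank_eq.symm)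

@[simp] lemma flat_apply (g : Metric I M) (x : M) (v w : TangentSpace I x) :
    flat g x v w = g.inner x v w := rfl

open Classical in
/-- The Levi-Civita connection of `g`: on differentiable vector fields `Y`, the vector `∇_X Y` is
determined by `g(∇_X Y, Z) = koszul g X Y Z` for all vector fields `Z`. As in the convention of
`CovariantDerivative`, `leviCivitaFun g Y x (X x)` is `(∇_X Y)(x)`; the value `0` is used where `Y`
is not differentiable. -/
def leviCivitaFun (g : Metric I M) (Y : Π x : M, TangentSpace I x) (x : M) :
    TangentSpace I x →L[ℝ] TangentSpace I x :=
  haveI : FiniteDimensional ℝ (TangentSpace I x) := inferInstanceAs (FiniteDimensional ℝ E)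
  haveI : T2Space (TangentSpace I x) := inferInstanceAs (T2Space E)
  if hY : MDiffAt (T% Y) x then
    LinearMap.toContinuousLinearMap
      ((flat g x).symm.toLinearMap ∘ₗ
        (TensorialAt.mkHom₂ (fun X Z ↦ koszul g X Y Z x) x
          (fun _ hZ ↦ koszul_tensorial_left g hY hZ)
          (fun _ hX ↦ koszul_tensorial_right g hX hY)).toLinearMap)
  else 0

/-- The Koszul formula. -/
lemma inner_leviCivitaFun (g : Metric I M) {X Y Z : Π x : M, TangentSpace I x} {x : M}
    (hX : MDiffAt (T% X) x) (hY : MDiffAt (T% Y) x) (hZ : MDiffAt (T% Z) x) :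
    g.inner x (leviCivitaFun g Y x (X x)) (Z x) = koszul g X Y Z x := by
  rw [← flat_apply]
  simp only [leviCivitaFun, dif_pos hY]
  simp
  exact TensorialAt.mkHom₂_apply _ _ hX hZ

lemma ext_inner (g : Metric I M) {x : M} {A B : TangentSpace I x →L[ℝ] TangentSpace I x}
    (h : ∀ X Z : Π x : M, TangentSpace I x, MDiffAt (T% X) x → MDiffAt (T% Z) x →
      g.inner x (A (X x)) (Z x) = g.inner x (B (X x)) (Z x)) : A = B := by
  ext v
  apply (flat g x).injective
  ext w
  have := h (FiberBundle.extend E v) (FiberBundle.extend E w)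
    (FiberBundle.mdifferentiableAt_extend ..) (FiberBundle.mdifferentiableAt_extend ..)
  simpa using this

/-- The Levi-Civita connection. -/
def leviCivita (g : Metric I M) : CovariantDerivative I E (fun x : M ↦ TangentSpace I x) where
  toFun := leviCivitaFun g
  isCovariantDerivativeOnUniv :=
    { add := by
        intro Y Y' x hY hY' _
        apply ext_inner g
        intro X Z hX hZ
        have h1 := mvfderiv_fun_add (mdiff_inner g hY hZ) (mdiff_inner g hY' hZ)
        have h2 := mvfderiv_fun_add (mdiff_inner g hX hY) (mdiff_inner g hX hY')
        have h3 := inner_leviCivitaFun g hX (mdifferentiableAt_add_section hY hY') hZ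
        rw [h3]
        simp only [add_apply, map_add, inner_leviCivitaFun g hX hY hZ,
          inner_leviCivitaFun g hX hY' hZ]
        simp [koszul, h1, h2, mlieBracket_add_left hY hY', mlieBracket_add_right hY hY']
        ring
      leibniz := by
        intro Y f x hY hf _
        apply ext_inner g
        intro X Z hX hZ
        have h1 := mvfderiv_fun_mul hf (mdiff_inner g hY hZ)
        have h2 := mvfderiv_fun_mul hf (mdiff_inner g hX hY)
        have h3 := inner_leviCivitaFun g hX (hf.smul_section hY) hZ
        rw [h3]
        simp [inner_leviCivitaFun g hX hY hZ]
        simp [koszul, h1, h2, mlieBracket_smul_left hf hY, mlieBracket_smul_right hf hY]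
        rw [g.symm x (Y x) (Z x), g.symm x (Y x) (X x)]
        ring }

/-- The Levi-Civita connection is torsion-free. -/
lemma leviCivita_torsion (g : Metric I M) {X Y : Π x : M, TangentSpace I x} {x : M}
    (hX : MDiffAt (T% X) x) (hY : MDiffAt (T% Y) x) :
    leviCivita g Y x (X x) - leviCivita g X x (Y x) = mlieBracket I X Y x := by
  apply (flat g x).injective
  ext w
  have hw : MDiffAt (T% (FiberBundle.extend E w : Π y : M, TangentSpace I y)) x :=
    FiberBundle.mdifferentiableAt_extend ..
  have h1 := inner_leviCivitaFun g hX hY hw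
  have h2 := inner_leviCivitaFun g hY hX hw
  simp only [FiberBundle.extend_apply_self] at h1 h2
  simp only [leviCivita, flat_apply, map_sub, sub_apply, h1, h2]
  have h3 : (fun y ↦ g.inner y (Y y) (X y)) = fun y ↦ g.inner y (X y) (Y y) :=
    funext fun y ↦ g.symm y _ _
  simp only [koszul, h3, mlieBracket_swap_apply (V := Y) (W := X)]
  simp
  ring

/-- The Levi-Civita connection is compatible with the metric. -/
lemma leviCivita_metric (g : Metric I M) {X Y Z : Π x : M, TangentSpace I x} {x : M}
    (hX : MDiffAt (T% X) x) (hY : MDiffAt (T% Y) x) (hZ : MDiffAt (T% Z) x) :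
    d% (fun y ↦ g.inner y (Y y) (Z y)) x (X x) =
      g.inner x (leviCivita g Y x (X x)) (Z x) + g.inner x (Y x) (leviCivita g Z x (X x)) := by
  have h1 := inner_leviCivitaFun g hX hY hZ
  have h2 := inner_leviCivitaFun g hX hZ hY
  rw [g.symm x (Y x)]
  simp only [leviCivita, h1, h2]
  have h3 : (fun y ↦ g.inner y (Z y) (Y y)) = fun y ↦ g.inner y (Y y) (Z y) :=
    funext fun y ↦ g.symm y _ _
  simp only [koszul, h3, mlieBracket_swap_apply (V := Z) (W := Y)]
  simp
  ring

/-- The curvature operator `R(X,Y)Z = ∇_X ∇_Y Z - ∇_Y ∇_X Z - ∇_{[X,Y]} Z` of a connection on the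
tangent bundle. -/
def curvatureOp (cov : CovariantDerivative I E (fun x : M ↦ TangentSpace I x))
    (X Y Z : Π x : M, TangentSpace I x) (x : M) : TangentSpace I x :=
  cov (fun y ↦ cov Z y (Y y)) x (X x) - cov (fun y ↦ cov Z y (X y)) x (Y x)
    - cov Z x (mlieBracket I X Y x)

/-- The curvature tensor `R(X,Y,Z,W) = g(R(X,Y)Z, W)`. -/
def curvature (g : Metric I M) (cov : CovariantDerivative I E (fun x : M ↦ TangentSpace I x))
    (X Y Z W : Π x : M, TangentSpace I x) (x : M) : ℝ :=
  g.inner x (curvatureOp cov X Y Z x) (W x)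

end Connections

section Structures

variable {E : Type*} [NormedAddCommGroup E] [NormedSpace ℝ E]
  [FiniteDimensional ℝ E] [CompleteSpace E]
  {H : Type*} [TopologicalSpace H] {I : ModelWithCorners ℝ E H}
  {M : Type*} [TopologicalSpace M] [ChartedSpace H M] [IsManifold I ∞ M]

/-- Smoothness of a vector field. -/
def IsSmooth (X : Π x : M, TangentSpace I x) : Prop :=
  ContMDiff I I.tangent ∞ (fun x ↦ (⟨x, X x⟩ : TangentBundle I M))

variable (I M) in
/-- An almost complex structure: a smooth field `J` of endomorphisms with `J ^ 2 = -1`. -/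
structure AlmostComplexStructure where
  toFun (x : M) : TangentSpace I x →L[ℝ] TangentSpace I x
  contMDiff : ContMDiff I (I.prod 𝓘(ℝ, E →L[ℝ] E)) ∞
    (fun x ↦ TotalSpace.mk' (E →L[ℝ] E) (E := fun x : M ↦ TangentSpace I x →L[ℝ] TangentSpace I x)
      x (toFun x))
  sq (x : M) (v : TangentSpace I x) : toFun x (toFun x v) = -v

/-- The vector field `J X`. -/
def AlmostComplexStructure.app (J : AlmostComplexStructure I M) (X : Π x : M, TangentSpace I x)
    (x : M) : TangentSpace I x :=
  J.toFun x (X x)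

/-- The Nijenhuis tensor `N_J(X,Y) = [JX,JY] - J[JX,Y] - J[X,JY] - [X,Y]`. -/
def AlmostComplexStructure.nijenhuis (J : AlmostComplexStructure I M)
    (X Y : Π x : M, TangentSpace I x) (x : M) : TangentSpace I x :=
  mlieBracket I (J.app X) (J.app Y) x - J.toFun x (mlieBracket I (J.app X) Y x)
    - J.toFun x (mlieBracket I X (J.app Y) x) - mlieBracket I X Y x

/-- `J` is integrable if its Nijenhuis tensor vanishes. -/
def AlmostComplexStructure.IsIntegrable (J : AlmostComplexStructure I M) : Prop :=
  ∀ X Y : Π x : M, TangentSpace I x, IsSmooth X → IsSmooth Y → ∀ x, J.nijenhuis X Y x = 0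

/-- The exterior derivative of a 2-form, evaluated on three vector fields. -/
def extDerivTwo (κ : Π x : M, TangentSpace I x →L[ℝ] TangentSpace I x →L[ℝ] ℝ)
    (X Y Z : Π x : M, TangentSpace I x) (x : M) : ℝ :=
  d% (fun y ↦ κ y (Y y) (Z y)) x (X x)
    - d% (fun y ↦ κ y (X y) (Z y)) x (Y x)
    + d% (fun y ↦ κ y (X y) (Y y)) x (Z x)
    - κ x (mlieBracket I X Y x) (Z x)
    + κ x (mlieBracket I X Z x) (Y x)
    - κ x (mlieBracket I Y Z x) (X x)

variable (I M) in
/-- A symplectic structure: a smooth, closed, non-degenerate 2-form. -/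
structure SymplecticForm where
  toFun (x : M) : TangentSpace I x →L[ℝ] TangentSpace I x →L[ℝ] ℝ
  contMDiff : ContMDiff I (I.prod 𝓘(ℝ, E →L[ℝ] E →L[ℝ] ℝ)) ∞
    (fun x ↦ TotalSpace.mk' (E →L[ℝ] E →L[ℝ] ℝ)
      (E := fun x : M ↦ TangentSpace I x →L[ℝ] TangentSpace I x →L[ℝ] ℝ) x (toFun x))
  alternating (x : M) (v : TangentSpace I x) : toFun x v v = 0
  nondegenerate (x : M) (v : TangentSpace I x) : (∀ w, toFun x v w = 0) → v = 0
  closed (X Y Z : Π x : M, TangentSpace I x) : IsSmooth X → IsSmooth Y → IsSmooth Z →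
    ∀ x, extDerivTwo toFun X Y Z x = 0

variable (I M) in
/-- An almost Kähler structure `(g, J, κ)`: the almost complex structure `J` is calibrated by the
symplectic form `κ`, with Riemannian metric `g(v,w) = κ(v, J w)`. -/
structure AlmostKahlerStructure where
  g : Metric I M
  J : AlmostComplexStructure I M
  κ : SymplecticForm I M
  calibrated (x : M) (v w : TangentSpace I x) : g.inner x v w = κ.toFun x v (J.toFun x w)

/-- An almost Kähler structure is Kähler if its almost complex structure is integrable. -/
def AlmostKahlerStructure.IsKahler (S : AlmostKahlerStructure I M) : Prop :=
  S.J.IsIntegrable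

lemma AlmostComplexStructure.mdiff_app (J : AlmostComplexStructure I M)
    {X : Π x : M, TangentSpace I x} {x : M} (hX : MDiffAt (T% X) x) :
    MDiffAt (T% (J.app X)) x := by
  apply MDifferentiableAt.clm_bundle_apply (F₁ := E) (F₂ := E)
    (E₁ := fun x : M ↦ TangentSpace I x) (E₂ := fun x : M ↦ TangentSpace I x)
  · exact J.contMDiff.mdifferentiableAt (by simp)
  · exact hX

/-- The Riemann curvature tensor `R` of `g`. -/
def AlmostKahlerStructure.riemannCurvature (S : AlmostKahlerStructure I M) :
    (Π x : M, TangentSpace I x) → (Π x : M, TangentSpace I x) → (Π x : M, TangentSpace I x) →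
      (Π x : M, TangentSpace I x) → M → ℝ :=
  curvature S.g (leviCivita S.g)

/-- The endomorphism `v ↦ (∇_v J) Y = ∇_v (J Y) - J (∇_v Y)` of the tangent space at `x`, where
`∇` is the Levi-Civita connection. -/
def AlmostKahlerStructure.covJ (S : AlmostKahlerStructure I M) (Y : Π x : M, TangentSpace I x)
    (x : M) : TangentSpace I x →L[ℝ] TangentSpace I x :=
  leviCivita S.g (S.J.app Y) x - (S.J.toFun x).comp (leviCivita S.g Y x)

/-- The Hermitian connection `∇ - (1/2) J (∇ J)`. -/
def AlmostKahlerStructure.hermitianConnection (S : AlmostKahlerStructure I M) :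
    CovariantDerivative I E (fun x : M ↦ TangentSpace I x) where
  toFun Y x := leviCivita S.g Y x - (1 / 2 : ℝ) • (S.J.toFun x).comp (S.covJ Y x)
  isCovariantDerivativeOnUniv :=
    { add := by
        intro Y Y' x hY hY' _
        have h1 := (leviCivita S.g).isCovariantDerivativeOnUniv.add hY hY'
        have h2 := (leviCivita S.g).isCovariantDerivativeOnUniv.add
          (S.J.mdiff_app hY) (S.J.mdiff_app hY')
        have h3 : S.J.app (Y + Y') = S.J.app Y + S.J.app Y' := by
          funext y; simp [AlmostComplexStructure.app]
        ext v
        simp [covJ, h1, h2, h3]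
        module
      leibniz := by
        intro Y f x hY hf _
        have h1 := (leviCivita S.g).isCovariantDerivativeOnUniv.leibniz hY hf
        have h2 := (leviCivita S.g).isCovariantDerivativeOnUniv.leibniz (S.J.mdiff_app hY) hf
        have h3 : S.J.app (f • Y) = f • S.J.app Y := by
          funext y; simp [AlmostComplexStructure.app]
        ext v
        simp [covJ, h1, h2, h3, AlmostComplexStructure.app]
        module }

/-- The Hermitian curvature tensor: the curvature tensor of the Hermitian connection. -/
def AlmostKahlerStructure.hermitianCurvature (S : AlmostKahlerStructure I M) :
    (Π x : M, TangentSpace I x) → (Π x : M, TangentSpace I x) → (Π x : M, TangentSpace I x) →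
      (Π x : M, TangentSpace I x) → M → ℝ :=
  curvature S.g S.hermitianConnection

end Structures

section Complexification

variable {E : Type*} [NormedAddCommGroup E] [NormedSpace ℝ E]
  {H : Type*} [TopologicalSpace H] {I : ModelWithCorners ℝ E H}
  {M : Type*} [TopologicalSpace M] [ChartedSpace H M] [IsManifold I ∞ M]

variable (I M) in
/-- A smooth complex vector field, that is, a smooth section `re + i im` of the complexified
tangent bundle `TM ⊗ ℂ = TM ⊕ i TM`. -/
structure ComplexVectorField where
  re (x : M) : TangentSpace I x
  im (x : M) : TangentSpace I x
  smooth_re : IsSmooth re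
  smooth_im : IsSmooth im

/-- The conjugate field `re - i im`. -/
def ComplexVectorField.conj (Z : ComplexVectorField I M) : ComplexVectorField I M where
  re := Z.re
  im := -Z.im
  smooth_re := Z.smooth_re
  smooth_im := Z.smooth_im.neg_section

/-- `Z` is of type `(1,0)` with respect to `J`, that is, `J Z = i Z` for the complex-linear
extension of `J`: the left-hand side is `J re + i J im` and the right-hand side `-im + i re`. -/
def ComplexVectorField.IsOneZero (J : AlmostComplexStructure I M)
    (Z : ComplexVectorField I M) : Prop :=
  ∀ x, J.toFun x (Z.re x) = -Z.im x ∧ J.toFun x (Z.im x) = Z.re x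

/-- The real (`0`) and imaginary (`1`) part of a complex vector field. -/
def ComplexVectorField.part (Z : ComplexVectorField I M) : Fin 2 → (Π x : M, TangentSpace I x) :=
  ![Z.re, Z.im]

/-- The complex-multilinear extension of a real 4-tensor `T`, evaluated on complex fields. -/
def complexify
    (T : (Π x : M, TangentSpace I x) → (Π x : M, TangentSpace I x) → (Π x : M, TangentSpace I x) →
      (Π x : M, TangentSpace I x) → M → ℝ)
    (Z₁ Z₂ Z₃ Z₄ : ComplexVectorField I M) (x : M) : ℂ :=
  ∑ a : Fin 2, ∑ b : Fin 2, ∑ c : Fin 2, ∑ d : Fin 2,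
    Complex.I ^ ((a : ℕ) + (b : ℕ) + (c : ℕ) + (d : ℕ)) *
      (T (Z₁.part a) (Z₂.part b) (Z₃.part c) (Z₄.part d) x : ℂ)

end Complexification

section Hypotheses

variable {E : Type*} [NormedAddCommGroup E] [NormedSpace ℝ E]
  [FiniteDimensional ℝ E] [CompleteSpace E]
  {H : Type*} [TopologicalSpace H] {I : ModelWithCorners ℝ E H}
  {M : Type*} [TopologicalSpace M] [ChartedSpace H M] [IsManifold I ∞ M]

/-- The Hermitian and Riemann curvature tensors agree on `(Z, conj Z, W, conj W)` for all fields
`Z`, `W` of type `(1,0)`. -/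
def AlmostKahlerStructure.CurvaturesAgreeComplex (S : AlmostKahlerStructure I M) : Prop :=
  ∀ Z W : ComplexVectorField I M, Z.IsOneZero S.J → W.IsOneZero S.J → ∀ x,
    complexify S.hermitianCurvature Z Z.conj W W.conj x
      = complexify S.riemannCurvature Z Z.conj W W.conj x

/-- The Hermitian and Riemann curvature tensors agree on `(X, J X, Y, J Y)` for all real vector
fields `X`, `Y`. -/
def AlmostKahlerStructure.CurvaturesAgreeReal (S : AlmostKahlerStructure I M) : Prop :=
  ∀ X Y : Π x : M, TangentSpace I x, IsSmooth X → IsSmooth Y → ∀ x,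
    S.hermitianCurvature X (S.J.app X) Y (S.J.app Y) x
      = S.riemannCurvature X (S.J.app X) Y (S.J.app Y) x

end Hypotheses

end AlmostKahler

end

/-! The Hermitian connection is the average of $\nabla$ and its conjugate $-J\nabla J$, so its
curvature is the average of $R(X,Y)$ and $-JR(X,Y)J$, minus a quarter of the commutator
$[\nabla_XJ,\nabla_YJ]$ (`curvatureOp_hermitianConnection`). Closedness of $\kappa$ forces
$\nabla_{JX}J=(\nabla_XJ)J$ (`nablaJ_app_left`), so for $Y=JX$ the commutator becomes
$2(\nabla_XJ)^2J$. Since $\nabla_XJ$ is skew, pairing with $JZ$ turns it into a square: $\widetilde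
R(X,JX,Z,JZ)=R(X,JX,Z,JZ)+\tfrac12|(\nabla_XJ)Z|^2$ (`hermitianCurvature_app`, with skewness of $R$
in its last pair).

Condition (b) therefore gives $\nabla J=0$. So does (a): for $X-iJX$ and $Y-iJY$ its real part
involves the same curvature terms. Conversely, $\nabla J=0$ gives $\widetilde\nabla=\nabla$, hence
both conditions, and it makes $N_J$ vanish because $\nabla$ is torsion-free.

All identities are stated for smooth fields, so $\nabla_XY$ must first be shown smooth, and skewness
of $R$ needs $[X,Y]f=XYf-YXf$. -/

noncomputable section

namespace AlmostKahler

/-! ### Smoothness of brackets and of the Levi-Civita derivative -/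

section Smoothness

variable {E : Type*} [NormedAddCommGroup E] [NormedSpace ℝ E]
  [FiniteDimensional ℝ E] [CompleteSpace E]
  {H : Type*} [TopologicalSpace H] {I : ModelWithCorners ℝ E H}
  {M : Type*} [TopologicalSpace M] [ChartedSpace H M] [IsManifold I ∞ M]

lemma contMDiffAt_inner (g : Metric I M) {X Y : Π x : M, TangentSpace I x} {x : M}
    (hX : CMDiffAt ∞ (T% X) x) (hY : CMDiffAt ∞ (T% Y) x) :
    CMDiffAt ∞ (fun y ↦ g.inner y (X y) (Y y)) x := by
  have h : ContMDiffAt I (I.prod 𝓘(ℝ, ℝ)) ∞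
      (fun m ↦ TotalSpace.mk' ℝ (E := Bundle.Trivial M ℝ) m (g.inner m (X m) (Y m))) x := by
    apply ContMDiffAt.clm_bundle_apply₂ (F₁ := E) (F₂ := E)
      (E₁ := fun x : M ↦ TangentSpace I x) (E₂ := fun x : M ↦ TangentSpace I x)
    · exact g.contMDiff.contMDiffAt
    · exact hX
    · exact hY
  simp only [contMDiffAt_totalSpace] at h
  exact h.2

lemma eventually_mdifferentiableAt_section {X : Π x : M, TangentSpace I x} {x : M}
    (hX : CMDiffAt ∞ (T% X) x) : ∀ᶠ y in nhds x, MDiffAt (T% X) y := by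
  have h1 : CMDiffAt 1 (T% X) x := hX.of_le (by simp)
  filter_upwards [(contMDiffAt_iff_contMDiffAt_nhds (by simp)).1 h1] with y hy
  exact hy.mdifferentiableAt (by simp)

lemma contMDiffAt_mvfderiv_apply {f : M → ℝ} {X : Π x : M, TangentSpace I x} {x : M}
    (hf : CMDiffAt ∞ f x) (hX : CMDiffAt ∞ (T% X) x) :
    CMDiffAt ∞ (fun y ↦ d% f y (X y)) x := by
  have h1 : CMDiffAt ∞ (inTangentCoordinates I 𝓘(ℝ, ℝ) id f (mfderiv% f) x) x :=
    hf.mfderiv_const (by simp)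
  have h2 := ContMDiffAt.clm_apply_of_inCoordinates (F₁ := E) (F₂ := ℝ)
    (E₁ := fun x : M ↦ TangentSpace I x) (E₂ := fun y : ℝ ↦ TangentSpace 𝓘(ℝ, ℝ) y)
    (b₁ := id) (b₂ := f) (ϕ := mfderiv% f) (v := X) h1 hX hf
  rw [contMDiffAt_totalSpace] at h2
  refine h2.2.congr_of_eventuallyEq (Filter.Eventually.of_forall fun y ↦ ?_)
  simp [mvfderiv]
  rfl

lemma contMDiffAt_mlieBracket {X Y : Π x : M, TangentSpace I x} {x : M}
    (hX : CMDiffAt ∞ (T% X) x) (hY : CMDiffAt ∞ (T% Y) x) :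
    CMDiffAt ∞ (T% (mlieBracket I X Y)) x := by
  -- The bracket costs one derivative, which is harmless because $\infty+1=\infty$.
  have : IsManifold I (((⊤ : ℕ∞) : ℕ∞ω) + 1) M := ‹IsManifold I ∞ M›
  have : IsManifold I (minSmoothness ℝ 2) M := .of_le (n := ∞) (by simpa using ENat.LEInfty.out)
  exact ContMDiffAt.mlieBracket_vectorField (n := ⊤) (m := ⊤) hX hY (by simp)

lemma contMDiffAt_koszul (g : Metric I M) {X Y Z : Π x : M, TangentSpace I x} {x : M}
    (hX : CMDiffAt ∞ (T% X) x) (hY : CMDiffAt ∞ (T% Y) x) (hZ : CMDiffAt ∞ (T% Z) x) :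
    CMDiffAt ∞ (koszul g X Y Z) x := by
  unfold koszul
  have d1 := contMDiffAt_mvfderiv_apply (contMDiffAt_inner g hY hZ) hX
  have d2 := contMDiffAt_mvfderiv_apply (contMDiffAt_inner g hX hZ) hY
  have d3 := contMDiffAt_mvfderiv_apply (contMDiffAt_inner g hX hY) hZ
  have b1 := contMDiffAt_inner g (contMDiffAt_mlieBracket hX hY) hZ
  have b2 := contMDiffAt_inner g (contMDiffAt_mlieBracket hX hZ) hY
  have b3 := contMDiffAt_inner g (contMDiffAt_mlieBracket hY hZ) hX
  exact contMDiffAt_const.mul (((((d1.add d2).sub d3).add b1).sub b2).sub b3)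

lemma contMDiffAt_det {ι : Type*} [Fintype ι] [DecidableEq ι] {A : M → Matrix ι ι ℝ} {x : M}
    (h : ∀ i j, CMDiffAt ∞ (fun y ↦ A y i j) x) : CMDiffAt ∞ (fun y ↦ (A y).det) x := by
  simp only [Matrix.det_apply']
  apply contMDiffAt_finsetSum
  intro σ _
  exact contMDiffAt_const.mul
    (contMDiffAt_finsetProd (f := fun i y ↦ A y (σ i) i) fun i _ ↦ h (σ i) i)

/-- A vector field is smooth at `x` if its inner products with locally smooth fields are. -/
lemma contMDiffAt_of_inner (g : Metric I M) {V : Π x : M, TangentSpace I x} {x : M}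
    (h : ∀ W : Π x : M, TangentSpace I x, CMDiffAt ∞ (T% W) x →
      CMDiffAt ∞ (fun y ↦ g.inner y (V y) (W y)) x) : CMDiffAt ∞ (T% V) x := by
  classical
  let e := trivializationAt E (fun x : M ↦ TangentSpace I x) x
  let b := Module.finBasis ℝ E
  have hx : x ∈ e.baseSet := FiberBundle.mem_baseSet_trivializationAt' x
  have hs := e.isLocalFrameOn_localFrame_baseSet I ∞ b
  let s := e.localFrame b
  have hsx (i) : CMDiffAt ∞ (T% (s i)) x := contMDiffAt_localFrame_of_mem ∞ e b i hx
  let G : M → Matrix _ _ ℝ := fun y ↦ Matrix.of fun i j ↦ g.inner y (s j y) (s i y)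
  let c : M → Fin _ → ℝ := fun y i ↦ g.inner y (V y) (s i y)
  have hG (i j) : CMDiffAt ∞ (fun y ↦ G y i j) x := contMDiffAt_inner g (hsx j) (hsx i)
  have hc (i) : CMDiffAt ∞ (fun y ↦ c y i) x := h _ (hsx i)
  -- A kernel vector `v` of the Gram matrix gives $w=\sum_j v_js_j$ with $g(w,w)=v\cdot Gv=0$, so
  -- $w=0$, contradicting independence of the frame.
  have hdet {y : M} (hy : y ∈ e.baseSet) : (G y).det ≠ 0 := by
    intro h0
    obtain ⟨v, hv, hv0⟩ := Matrix.exists_mulVec_eq_zero_iff.2 h0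
    have h1 : ∑ j, v j • s j y = 0 := by
      by_contra hne
      have h2 := g.pos y _ hne
      have h3 : g.inner y (∑ j, v j • s j y) (∑ j, v j • s j y)
          = ∑ i, v i * (G y).mulVec v i := by
        conv_lhs => rw [map_sum (g.inner y (∑ j, v j • s j y))]
        refine Finset.sum_congr rfl fun i _ ↦ ?_
        simp [Matrix.mulVec, dotProduct, G, mul_comm]
      rw [h3, hv0] at h2
      simp at h2
    exact hv (funext fun i ↦ (Fintype.linearIndependent_iff.1 (hs.linearIndependent hy)) v h1 i)
  -- Cramer's rule writes the frame coefficients of `V` as quotients of determinants in the smooth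
  -- functions $g(s_j,s_i)$ and $g(V,s_i)$.
  have key {y : M} (hy : y ∈ e.baseSet) (i) :
      hs.coeff i y (V y) = ((G y).updateCol i (c y)).det / (G y).det := by
    have h1 : (G y).mulVec (fun i ↦ hs.coeff i y (V y)) = c y := by
      funext k
      simp only [c]
      conv_rhs => rw [hs.coeff_sum_eq V hy]
      simp [Matrix.mulVec, dotProduct, G, mul_comm, s]
    rw [← Matrix.cramer_apply, ← h1, Matrix.cramer_eq_adjugate_mulVec, Matrix.mulVec_mulVec,
      Matrix.adjugate_mul]
    simp [Matrix.smul_mulVec, hdet hy]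
  refine hs.contMDiffAt_of_coeff (fun i ↦ ?_) (e.open_baseSet.mem_nhds hx)
  have h1 : CMDiffAt ∞ (fun y ↦ ((G y).updateCol i (c y)).det / (G y).det) x := by
    refine ContMDiffAt.div₀ (contMDiffAt_det fun k l ↦ ?_) (contMDiffAt_det hG) (hdet hx)
    simp only [Matrix.updateCol_apply]
    split_ifs
    · exact hc k
    · exact hG k l
  refine h1.congr_of_eventuallyEq ?_
  filter_upwards [e.open_baseSet.mem_nhds hx] with y hy
  exact key hy i

lemma IsSmooth.mdifferentiableAt {X : Π x : M, TangentSpace I x} (hX : IsSmooth X) (x : M) :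
    MDiffAt (T% X) x :=
  ContMDiff.mdifferentiable hX (by simp) x

/-- By the Koszul formula, the inner products of $\nabla_XY$ with smooth fields are smooth. The
formula is needed on a whole neighbourhood, where the test field remains differentiable. -/
lemma IsSmooth.leviCivita (g : Metric I M) {X Y : Π x : M, TangentSpace I x}
    (hX : IsSmooth X) (hY : IsSmooth Y) : IsSmooth fun x ↦ leviCivita g Y x (X x) := by
  intro x
  refine contMDiffAt_of_inner g fun W hW ↦ ?_
  refine (contMDiffAt_koszul g (hX x) (hY x) hW).congr_of_eventuallyEq ?_
  filter_upwards [eventually_mdifferentiableAt_section hW] with y hy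
  exact inner_leviCivitaFun g (hX.mdifferentiableAt y) (hY.mdifferentiableAt y) hy

lemma IsSmooth.mlieBracket {X Y : Π x : M, TangentSpace I x}
    (hX : IsSmooth X) (hY : IsSmooth Y) : IsSmooth (VectorField.mlieBracket I X Y) :=
  fun x ↦ contMDiffAt_mlieBracket (hX x) (hY x)

lemma IsSmooth.app (J : AlmostComplexStructure I M) {X : Π x : M, TangentSpace I x}
    (hX : IsSmooth X) : IsSmooth (J.app X) := by
  intro x
  apply ContMDiffAt.clm_bundle_apply (F₁ := E) (F₂ := E)
    (E₁ := fun x : M ↦ TangentSpace I x) (E₂ := fun x : M ↦ TangentSpace I x)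
  · exact J.contMDiff.contMDiffAt
  · exact hX x

/-- The Lie bracket acts on functions as the commutator of derivations. -/
lemma mvfderiv_mlieBracket {X Y : Π x : M, TangentSpace I x} {f : M → ℝ} {x : M}
    (hX : CMDiffAt ∞ (T% X) x) (hY : CMDiffAt ∞ (T% Y) x) (hf : CMDiffAt ∞ f x) :
    d% f x (mlieBracket I X Y x)
      = d% (fun y ↦ d% f y (Y y)) x (X x) - d% (fun y ↦ d% f y (X y)) x (Y x) := by
  -- The argument compares coefficients of a nonzero vector, so a trivial tangent space is treated
  -- apart.
  by_cases h0 : ∀ v : TangentSpace I x, v = 0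
  · rw [h0 (mlieBracket I X Y x), h0 (X x), h0 (Y x)]
    simp
  push Not at h0
  obtain ⟨v, hv⟩ := h0
  let Z : Π x : M, TangentSpace I x := FiberBundle.extend E v
  have hZ : CMDiffAt ∞ (T% Z) x := FiberBundle.contMDiffAt_extend ..
  have hZv : Z x = v := by simp [Z]
  have : IsManifold I (minSmoothness ℝ 3) M := .of_le (n := ∞) (by simpa using ENat.LEInfty.out)
  have dX := contMDiffAt_mvfderiv_apply hf hX
  have dY := contMDiffAt_mvfderiv_apply hf hY
  have md {W : Π x : M, TangentSpace I x} (h : CMDiffAt ∞ (T% W) x) : MDiffAt (T% W) x :=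
    h.mdifferentiableAt (by simp)
  have mf {k : M → ℝ} (h : CMDiffAt ∞ k x) : MDiffAt k x := h.mdifferentiableAt (by simp)
  have sm {W : Π x : M, TangentSpace I x} {k : M → ℝ} (hk : CMDiffAt ∞ k x)
      (h : CMDiffAt ∞ (T% W) x) : CMDiffAt ∞ (T% (k • W)) x := hk.smul_section h
  have hle : minSmoothness ℝ 2 ≤ (∞ : ℕ∞ω) := by simpa using ENat.LEInfty.out
  have jac {U V W : Π x : M, TangentSpace I x} (hU : CMDiffAt ∞ (T% U) x)
      (hV : CMDiffAt ∞ (T% V) x) (hW : CMDiffAt ∞ (T% W) x) :=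
    leibniz_identity_mlieBracket_apply (hU.of_le hle) (hV.of_le hle) (hW.of_le hle)
  have ev {U : Π x : M, TangentSpace I x} :
      mlieBracket I U (f • Z) =ᶠ[nhds x]
        (fun y ↦ d% f y (U y)) • Z + f • mlieBracket I U Z := by
    have hf1 : CMDiffAt 1 f x := hf.of_le (by simp)
    filter_upwards [eventually_mdifferentiableAt_section hZ,
      (contMDiffAt_iff_contMDiffAt_nhds (by simp)).1 hf1] with y h1 h2
    exact mlieBracket_smul_right (h2.mdifferentiableAt (by simp)) h1
  have br {U W : Π x : M, TangentSpace I x} (hU : CMDiffAt ∞ (T% U) x)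
      (hW : CMDiffAt ∞ (T% W) x) :
      mlieBracket I W (mlieBracket I U (f • Z)) x =
        d% (fun y ↦ d% f y (U y)) x (W x) • v + d% f x (U x) • mlieBracket I W Z x
          + (d% f x (W x) • mlieBracket I U Z x
            + f x • mlieBracket I W (mlieBracket I U Z) x) := by
    have dU := contMDiffAt_mvfderiv_apply hf hU
    have hUZ := contMDiffAt_mlieBracket hU hZ
    rw [Filter.EventuallyEq.mlieBracket_vectorField_eq (Filter.EventuallyEq.refl _ W) ev,
      mlieBracket_add_right (md (sm dU hZ)) (md (sm hf hUZ)),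
      mlieBracket_smul_right (mf dU) (md hZ), mlieBracket_smul_right (mf hf) (md hUZ), hZv]
  -- In the Jacobi identity for $X$, $Y$, $fZ$, the Jacobi identity for $X$, $Y$, $Z$ and the mixed
  -- first-order terms cancel. What remains is $([X,Y]f-XYf+YXf)\,Z=0$.
  have h1 := jac hX hY (sm hf hZ)
  rw [br hY hX, br hX hY, mlieBracket_smul_right (mf hf) (md hZ), jac hX hY hZ, hZv] at h1
  have h2 : (d% f x (mlieBracket I X Y x)
      - (d% (fun y ↦ d% f y (Y y)) x (X x) - d% (fun y ↦ d% f y (X y)) x (Y x))) • v = 0 := by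
    rw [← sub_eq_zero] at h1
    rw [← neg_eq_zero, ← h1]
    module
  exact sub_eq_zero.1 ((smul_eq_zero.1 h2).resolve_right hv)

end Smoothness

end AlmostKahler

namespace AlmostKahler

/-! ### Curvature operators and covariant derivatives along fields -/

section Curvature

variable {E : Type*} [NormedAddCommGroup E] [NormedSpace ℝ E]
  [FiniteDimensional ℝ E] [CompleteSpace E]
  {H : Type*} [TopologicalSpace H] {I : ModelWithCorners ℝ E H}
  {M : Type*} [TopologicalSpace M] [ChartedSpace H M] [IsManifold I ∞ M]

lemma IsSmooth.sub {X Y : Π x : M, TangentSpace I x} (hX : IsSmooth X) (hY : IsSmooth Y) :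
    IsSmooth (X - Y) :=
  ContMDiff.sub_section hX hY

lemma IsSmooth.neg {X : Π x : M, TangentSpace I x} (hX : IsSmooth X) : IsSmooth (-X) :=
  ContMDiff.neg_section hX

lemma IsSmooth.const_smul {X : Π x : M, TangentSpace I x} (c : ℝ) (hX : IsSmooth X) :
    IsSmooth (c • X) :=
  ContMDiff.const_smul_section hX

/-- The derivative `∇_X Y` of the vector field `Y` along `X`. -/
def along (cov : CovariantDerivative I E (fun x : M ↦ TangentSpace I x))
    (X Y : Π x : M, TangentSpace I x) (x : M) : TangentSpace I x :=
  cov Y x (X x)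

section Along

variable (cov : CovariantDerivative I E (fun x : M ↦ TangentSpace I x))
  {X Y Z : Π x : M, TangentSpace I x}

lemma along_add_right (hY : IsSmooth Y) (hZ : IsSmooth Z) :
    along cov X (Y + Z) = along cov X Y + along cov X Z := by
  funext x
  simp [along, cov.isCovariantDerivativeOnUniv.add (hY.mdifferentiableAt x)
    (hZ.mdifferentiableAt x)]

lemma along_smul_right (c : ℝ) (hY : IsSmooth Y) :
    along cov X (c • Y) = c • along cov X Y := by
  funext x
  simp [along, cov.isCovariantDerivativeOnUniv.smul_const c (hY.mdifferentiableAt x)]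

lemma along_neg_right (hY : IsSmooth Y) : along cov X (-Y) = -along cov X Y := by
  simpa using along_smul_right cov (X := X) (-1) hY

lemma along_sub_right (hY : IsSmooth Y) (hZ : IsSmooth Z) :
    along cov X (Y - Z) = along cov X Y - along cov X Z := by
  rw [sub_eq_add_neg, along_add_right cov hY hZ.neg, along_neg_right cov hZ, ← sub_eq_add_neg]

lemma along_neg_left : along cov (-X) Y = -along cov X Y := by
  funext x
  simp [along]

lemma curvatureOp_eq_along (x : M) : curvatureOp cov X Y Z x =
    along cov X (along cov Y Z) x - along cov Y (along cov X Z) x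
      - along cov (mlieBracket I X Y) Z x := rfl

lemma curvatureOp_swap (x : M) : curvatureOp cov Y X Z x = -curvatureOp cov X Y Z x := by
  simp only [curvatureOp, mlieBracket_swap_apply (V := Y) (W := X), map_neg]
  abel

lemma curvatureOp_self (x : M) : curvatureOp cov X X Z x = 0 := by
  simp [curvatureOp]

variable {cov}

/-- Full tensoriality of the curvature is not required: sign changes suffice for the fields $X\mp
iJX$. The hypothesis `hcov` lets the argument serve both connections. -/
lemma curvatureOp_neg_left
    (hcov : ∀ {U V : Π x : M, TangentSpace I x}, IsSmooth U → IsSmooth V → IsSmooth (along cov U V))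
    (hX : IsSmooth X) (hZ : IsSmooth Z) (x : M) :
    curvatureOp cov (-X) Y Z x = -curvatureOp cov X Y Z x := by
  have h : mlieBracket I (-X) Y x = -mlieBracket I X Y x := by
    simpa using mlieBracket_const_smul_left (c := (-1 : ℝ)) (W := Y) (hX.mdifferentiableAt x)
  simp only [curvatureOp_eq_along, along_neg_left, along_neg_right cov (hcov hX hZ), Pi.neg_apply]
  simp only [along, h, map_neg]
  abel

lemma curvatureOp_neg_right
    (hcov : ∀ {U V : Π x : M, TangentSpace I x}, IsSmooth U → IsSmooth V → IsSmooth (along cov U V))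
    (hX : IsSmooth X) (hY : IsSmooth Y) (hZ : IsSmooth Z) (x : M) :
    curvatureOp cov X Y (-Z) x = -curvatureOp cov X Y Z x := by
  simp only [curvatureOp_eq_along, along_neg_right cov hZ, along_neg_right cov (hcov hX hZ),
    along_neg_right cov (hcov hY hZ), Pi.neg_apply]
  abel

end Along

lemma IsSmooth.along_leviCivita (g : Metric I M) {X Y : Π x : M, TangentSpace I x}
    (hX : IsSmooth X) (hY : IsSmooth Y) : IsSmooth (along (AlmostKahler.leviCivita g) X Y) :=
  IsSmooth.leviCivita g hX hY

lemma mvfderiv_inner_eq_along (g : Metric I M) {X Y Z : Π x : M, TangentSpace I x}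
    (hX : IsSmooth X) (hY : IsSmooth Y) (hZ : IsSmooth Z) (x : M) :
    d% (fun y ↦ g.inner y (Y y) (Z y)) x (X x) =
      g.inner x (along (leviCivita g) X Y x) (Z x)
        + g.inner x (Y x) (along (leviCivita g) X Z x) :=
  leviCivita_metric g (hX.mdifferentiableAt x) (hY.mdifferentiableAt x) (hZ.mdifferentiableAt x)

/-- The Riemann curvature operator is skew-symmetric. -/
lemma inner_curvatureOp_leviCivita_skew (g : Metric I M) {X Y Z W : Π x : M, TangentSpace I x}
    (hX : IsSmooth X) (hY : IsSmooth Y) (hZ : IsSmooth Z) (hW : IsSmooth W) (x : M) :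
    g.inner x (curvatureOp (leviCivita g) X Y Z x) (W x)
      = -g.inner x (curvatureOp (leviCivita g) X Y W x) (Z x) := by
  have hf : CMDiffAt ∞ (fun y ↦ g.inner y (Z y) (W y)) x := contMDiffAt_inner g (hZ x) (hW x)
  have hcomm := mvfderiv_mlieBracket (hX x) (hY x) hf
  have md {U V : Π x : M, TangentSpace I x} (hU : IsSmooth U) (hV : IsSmooth V) :=
    mdiff_inner g (hU.mdifferentiableAt x) (hV.mdifferentiableAt x)
  -- The two mixed terms are together symmetric in `U` and `V`, so they drop out of the commutator
  -- of second derivatives.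
  have second {U V : Π x : M, TangentSpace I x} (hU : IsSmooth U) (hV : IsSmooth V) :
      d% (fun y ↦ d% (fun y ↦ g.inner y (Z y) (W y)) y (V y)) x (U x) =
        g.inner x (along (leviCivita g) U (along (leviCivita g) V Z) x) (W x)
          + g.inner x (along (leviCivita g) V Z x) (along (leviCivita g) U W x)
          + (g.inner x (along (leviCivita g) U Z x) (along (leviCivita g) V W x)
          + g.inner x (Z x) (along (leviCivita g) U (along (leviCivita g) V W) x)) := by
    have h1 := funext fun y ↦ mvfderiv_inner_eq_along g hV hZ hW y
    rw [h1, mvfderiv_fun_add (md (hV.along_leviCivita g hZ) hW)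
      (md hZ (hV.along_leviCivita g hW)), add_apply,
      mvfderiv_inner_eq_along g hU (hV.along_leviCivita g hZ) hW,
      mvfderiv_inner_eq_along g hU hZ (hV.along_leviCivita g hW)]
  rw [second hX hY, second hY hX, mvfderiv_inner_eq_along g (hX.mlieBracket hY) hZ hW] at hcomm
  rw [g.symm x _ (Z x)]
  simp only [curvatureOp_eq_along, map_sub, sub_apply]
  linarith

/-! ### The covariant derivative of $J$ -/

namespace AlmostKahlerStructure

variable (S : AlmostKahlerStructure I M) {X Y Z : Π x : M, TangentSpace I x}

lemma inner_J_left (x : M) (v w : TangentSpace I x) :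
    S.g.inner x (S.J.toFun x v) w = -S.g.inner x v (S.J.toFun x w) := by
  have halt : S.κ.toFun x w v = -S.κ.toFun x v w := by
    have h := S.κ.alternating x (v + w)
    simp only [map_add, add_apply, S.κ.alternating, zero_add, add_zero] at h
    linarith
  rw [S.g.symm, S.calibrated, S.calibrated, S.J.sq, S.J.sq, map_neg, map_neg, halt]

lemma kappa_eq (x : M) (v w : TangentSpace I x) :
    S.κ.toFun x v w = S.g.inner x (S.J.toFun x v) w := by
  rw [inner_J_left, S.calibrated, S.J.sq, map_neg, neg_neg]

lemma inner_J_J (x : M) (v w : TangentSpace I x) :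
    S.g.inner x (S.J.toFun x v) (S.J.toFun x w) = S.g.inner x v w := by
  rw [inner_J_left, S.J.sq, map_neg, neg_neg]

lemma app_app : S.J.app (S.J.app X) = -X :=
  funext fun x ↦ S.J.sq x (X x)

lemma app_apply (x : M) : S.J.app X x = S.J.toFun x (X x) := rfl

lemma app_neg : S.J.app (-X) = -S.J.app X := by
  funext x; simp [AlmostComplexStructure.app]

lemma app_sub : S.J.app (X - Y) = S.J.app X - S.J.app Y := by
  funext x; simp [AlmostComplexStructure.app]

lemma app_smul (c : ℝ) : S.J.app (c • X) = c • S.J.app X := by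
  funext x; simp [AlmostComplexStructure.app]

/-- The vector field `(∇_X J) Y`. -/
def nablaJ (X Y : Π x : M, TangentSpace I x) : Π x : M, TangentSpace I x :=
  along (leviCivita S.g) X (S.J.app Y) - S.J.app (along (leviCivita S.g) X Y)

variable {S} in
lemma _root_.AlmostKahler.IsSmooth.nablaJ (hX : IsSmooth X) (hY : IsSmooth Y) :
    IsSmooth (S.nablaJ X Y) :=
  (hX.along_leviCivita S.g (hY.app S.J)).sub ((hX.along_leviCivita S.g hY).app S.J)

lemma along_app : along (leviCivita S.g) X (S.J.app Y)
    = S.J.app (along (leviCivita S.g) X Y) + S.nablaJ X Y := by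
  simp [nablaJ]

/-- `∇_X J` anticommutes with `J`. -/
lemma nablaJ_app (hY : IsSmooth Y) : S.nablaJ X (S.J.app Y) = -S.J.app (S.nablaJ X Y) := by
  simp only [nablaJ, app_app, app_sub, along_neg_right _ hY]
  abel

lemma nablaJ_sub_right (hY : IsSmooth Y) (hZ : IsSmooth Z) :
    S.nablaJ X (Y - Z) = S.nablaJ X Y - S.nablaJ X Z := by
  simp only [nablaJ, app_sub, along_sub_right _ hY hZ,
    along_sub_right _ (hY.app S.J) (hZ.app S.J)]
  abel

lemma nablaJ_neg_right (hY : IsSmooth Y) : S.nablaJ X (-Y) = -S.nablaJ X Y := by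
  simp only [nablaJ, app_neg, along_neg_right _ hY, along_neg_right _ (hY.app S.J)]
  abel

/-- `∇_X J` is skew-symmetric. -/
lemma inner_nablaJ_skew (hX : IsSmooth X) (hY : IsSmooth Y) (hZ : IsSmooth Z) (x : M) :
    S.g.inner x (S.nablaJ X Y x) (Z x) = -S.g.inner x (Y x) (S.nablaJ X Z x) := by
  -- Both sides of $g(JY,Z)=-g(Y,JZ)$ are differentiated along $X$.
  have h1 := mvfderiv_inner_eq_along S.g hX (hY.app S.J) hZ x
  have h2 := mvfderiv_inner_eq_along S.g hX hY (hZ.app S.J) x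
  have h3 : (fun y ↦ S.g.inner y (S.J.app Y y) (Z y))
      = -fun y ↦ S.g.inner y (Y y) (S.J.app Z y) :=
    funext fun y ↦ S.inner_J_left y _ _
  rw [h3, mvfderiv_neg, neg_apply, h2] at h1
  simp only [along_app, Pi.add_apply, map_add, add_apply, app_apply, inner_J_left] at h1
  linarith

/-- The closedness of the symplectic form in terms of `∇J`. -/
lemma inner_nablaJ_cyclic (hX : IsSmooth X) (hY : IsSmooth Y) (hZ : IsSmooth Z) (x : M) :
    S.g.inner x (S.nablaJ X Y x) (Z x) + S.g.inner x (S.nablaJ Y Z x) (X x)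
      + S.g.inner x (S.nablaJ Z X x) (Y x) = 0 := by
  have hc := S.κ.closed X Y Z hX hY hZ x
  have hd {U V W : Π x : M, TangentSpace I x} (hU : IsSmooth U) (hV : IsSmooth V)
      (hW : IsSmooth W) : d% (fun y ↦ S.κ.toFun y (V y) (W y)) x (U x) = _ :=
    (congrArg (fun f : M → ℝ ↦ d% f x (U x)) (funext fun y ↦ S.kappa_eq y (V y) (W y))).trans
      (mvfderiv_inner_eq_along S.g hU (hV.app S.J) hW x)
  -- With $\kappa(v,w)=g(Jv,w)$ and brackets expressed by the torsion-free $\nabla$, all terms of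
  -- $d\kappa$ without $\nabla J$ cancel.
  have hb {U V : Π x : M, TangentSpace I x} (hU : IsSmooth U) (hV : IsSmooth V) :
      mlieBracket I U V x = along (leviCivita S.g) U V x - along (leviCivita S.g) V U x :=
    (leviCivita_torsion S.g (hU.mdifferentiableAt x) (hV.mdifferentiableAt x)).symm
  have hs := S.inner_nablaJ_skew hY hX hZ x
  rw [S.g.symm x (X x)] at hs
  rw [extDerivTwo, hd hX hY hZ, hd hY hX hZ, hd hZ hX hY, hb hX hY, hb hX hZ, hb hY hZ] at hc
  simp only [kappa_eq, along_app, app_apply, Pi.add_apply, map_sub, map_add, sub_apply,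
    add_apply] at hc
  have sk (v w : TangentSpace I x) :
      S.g.inner x (S.J.toFun x v) w = -S.g.inner x (S.J.toFun x w) v := by
    rw [inner_J_left, S.g.symm]
  rw [sk (along (leviCivita S.g) X Z x) (Y x), sk (along (leviCivita S.g) Y Z x) (X x),
    sk (along (leviCivita S.g) Z Y x) (X x)] at hc
  linarith

/-- An almost Kähler manifold is quasi-Kähler. -/
lemma nablaJ_app_left (hX : IsSmooth X) (hY : IsSmooth Y) :
    S.nablaJ (S.J.app X) Y = S.nablaJ X (S.J.app Y) := by
  -- Write $a(U,V,W)=g((\nabla_UJ)V,W)$. As $J$ is skew and anticommutes with $\nabla_UJ$, it can be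
  -- moved from the second slot of $a$ to the third.
  have move {U V W : Π x : M, TangentSpace I x} (hV : IsSmooth V) (x : M) :
      S.g.inner x (S.nablaJ U (S.J.app V) x) (W x)
        = S.g.inner x (S.nablaJ U V x) (S.J.app W x) := by
    rw [S.nablaJ_app hV, Pi.neg_apply, map_neg, neg_apply, app_apply, inner_J_left, neg_neg]
    rfl
  have main {Z : Π x : M, TangentSpace I x} (hZ : IsSmooth Z) (x : M) :
      S.g.inner x (S.nablaJ (S.J.app X) Y x) (Z x)
        = S.g.inner x (S.nablaJ X (S.J.app Y) x) (Z x) := by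
    have key {Y : Π x : M, TangentSpace I x} (hY : IsSmooth Y) :
        S.g.inner x (S.nablaJ (S.J.app X) (S.J.app Y) x) (Z x)
          = -S.g.inner x (S.nablaJ X Y x) (Z x) := by
      -- The last three cyclic identities are linear equations for $a(JX,Y,JZ)$, $a(JY,Z,JX)$,
      -- $a(JZ,X,JY)$. Solving for the first and using the identity for $X$, $Y$, $Z$ gives
      -- $-a(X,Y,Z)$.
      have h0 := S.inner_nablaJ_cyclic hX hY hZ x
      have h1 := S.inner_nablaJ_cyclic hX (hY.app S.J) (hZ.app S.J) x
      have h2 := S.inner_nablaJ_cyclic (hX.app S.J) hY (hZ.app S.J) x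
      have h3 := S.inner_nablaJ_cyclic (hX.app S.J) (hY.app S.J) hZ x
      simp only [move hX, move hY, move hZ, app_app, Pi.neg_apply, map_neg] at h1 h2 h3 ⊢
      linarith
    have h := key (hY.app S.J)
    rw [app_app, nablaJ_neg_right _ hY] at h
    simpa using h
  funext x
  -- The difference of the two sides is itself a smooth field, so it may be tested against itself.
  have hd : IsSmooth (S.nablaJ (S.J.app X) Y - S.nablaJ X (S.J.app Y)) :=
    ((hX.app S.J).nablaJ hY).sub (hX.nablaJ (hY.app S.J))
  by_contra hne
  have hpos := S.g.pos x _ (sub_ne_zero.2 hne)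
  have h := main hd x
  simp only [Pi.sub_apply, map_sub, sub_apply] at h hpos
  linarith

/-! ### The Hermitian connection and its curvature -/

lemma along_hermitianConnection : along S.hermitianConnection X Y
    = along (leviCivita S.g) X Y - (1 / 2 : ℝ) • S.J.app (S.nablaJ X Y) := rfl

/-- Written as the average of $\nabla$ and $-J\nabla J$, the connection has second derivatives in
which most terms telescope through $J^2=-1$. -/
lemma along_hermitianConnection_eq : along S.hermitianConnection X Y
    = (1 / 2 : ℝ) • (along (leviCivita S.g) X Y
      - S.J.app (along (leviCivita S.g) X (S.J.app Y))) := by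
  rw [along_hermitianConnection, nablaJ, app_sub, app_app]
  module

variable {S} in
lemma _root_.AlmostKahler.IsSmooth.along_hermitianConnection (hX : IsSmooth X) (hY : IsSmooth Y) :
    IsSmooth (along S.hermitianConnection X Y) :=
  (hX.along_leviCivita S.g hY).sub (((hX.nablaJ hY).app S.J).const_smul _)

/-- Compared with the average of the two iterated derivatives, the only error is quadratic in
$\nabla J$. The auxiliary identity `h3` rewrites this error so that it matches the cross terms. -/
lemma along_along_hermitianConnection (hY : IsSmooth Y) (hZ : IsSmooth Z) :
    along S.hermitianConnection X (along S.hermitianConnection Y Z)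
      = (1 / 2 : ℝ) • (along (leviCivita S.g) X (along (leviCivita S.g) Y Z)
          - S.J.app (along (leviCivita S.g) X (along (leviCivita S.g) Y (S.J.app Z))))
        - (1 / 4 : ℝ) • S.nablaJ X (S.nablaJ Y Z) := by
  have h1 : IsSmooth (along (leviCivita S.g) Y Z) := hY.along_leviCivita S.g hZ
  have h2 : IsSmooth (along (leviCivita S.g) Y (S.J.app Z)) := hY.along_leviCivita S.g (hZ.app S.J)
  have h3 : S.nablaJ X (S.nablaJ Y Z) = S.nablaJ X (along (leviCivita S.g) Y (S.J.app Z))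
      + S.J.app (S.nablaJ X (along (leviCivita S.g) Y Z)) := by
    rw [nablaJ.eq_1 S Y Z, nablaJ_sub_right _ h2 (h1.app S.J), nablaJ_app _ h1, sub_neg_eq_add]
  rw [along_hermitianConnection_eq, along_hermitianConnection_eq, app_smul, app_sub, app_app,
    along_smul_right _ _ (h1.sub (h2.app S.J)),
    along_smul_right _ _ ((h1.app S.J).sub h2.neg),
    along_sub_right _ h1 (h2.app S.J), along_sub_right _ (h1.app S.J) h2.neg,
    along_neg_right _ h2, h3, S.along_app (Y := along (leviCivita S.g) Y Z),
    S.along_app (Y := along (leviCivita S.g) Y (S.J.app Z))]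
  funext x
  simp only [AlmostComplexStructure.app, Pi.add_apply, Pi.sub_apply, Pi.smul_apply, Pi.neg_apply,
    map_add, map_sub, map_smul, map_neg, S.J.sq]
  module

/-- The Hermitian curvature operator in terms of the Riemann curvature operator and `∇J`. -/
lemma curvatureOp_hermitianConnection (hX : IsSmooth X) (hY : IsSmooth Y) (hZ : IsSmooth Z)
    (x : M) :
    curvatureOp S.hermitianConnection X Y Z x
      = (1 / 2 : ℝ) • (curvatureOp (leviCivita S.g) X Y Z x
          - S.J.toFun x (curvatureOp (leviCivita S.g) X Y (S.J.app Z) x))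
        - (1 / 4 : ℝ) • (S.nablaJ X (S.nablaJ Y Z) x - S.nablaJ Y (S.nablaJ X Z) x) := by
  rw [curvatureOp_eq_along, along_along_hermitianConnection S hY hZ,
    along_along_hermitianConnection S hX hZ, along_hermitianConnection_eq]
  simp only [curvatureOp_eq_along, AlmostComplexStructure.app, Pi.sub_apply, Pi.smul_apply,
    map_sub]
  module

/-- With $A=\nabla_XJ$, the quasi-Kähler identity gives $\nabla_{JX}J=AJ$, and $AJ=-JA$ makes the
two halves of the commutator add up instead of cancelling. -/
lemma nablaJ_commutator (hX : IsSmooth X) (hZ : IsSmooth Z) :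
    S.nablaJ X (S.nablaJ (S.J.app X) Z) - S.nablaJ (S.J.app X) (S.nablaJ X Z)
      = (2 : ℝ) • S.nablaJ X (S.nablaJ X (S.J.app Z)) := by
  rw [nablaJ_app_left _ hX hZ, nablaJ_app_left _ hX (hX.nablaJ hZ), nablaJ_app _ hZ,
    nablaJ_neg_right _ ((hX.nablaJ hZ).app S.J)]
  module

/-- The commutator term is $-\tfrac12g(A^2JZ,JZ)$ with $A=\nabla_XJ$. It equals
$\tfrac12|AJZ|^2=\tfrac12|AZ|^2$, because $A$ is skew and anticommutes with the isometry $J$. -/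
lemma hermitianCurvature_app (hX : IsSmooth X) (hZ : IsSmooth Z) (x : M) :
    S.hermitianCurvature X (S.J.app X) Z (S.J.app Z) x
      = (1 / 2) * (S.riemannCurvature X (S.J.app X) Z (S.J.app Z) x
          - S.riemannCurvature X (S.J.app X) (S.J.app Z) Z x)
        + (1 / 2) * S.g.inner x (S.nablaJ X Z x) (S.nablaJ X Z x) := by
  have hJZ := hZ.app S.J
  have h := congrFun (S.nablaJ_commutator hX hZ) x
  have h1 := S.inner_nablaJ_skew hX (hX.nablaJ (S := S) hJZ) hJZ x
  have h2 : S.g.inner x (S.nablaJ X (S.J.app Z) x) (S.nablaJ X (S.J.app Z) x)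
      = S.g.inner x (S.nablaJ X Z x) (S.nablaJ X Z x) := by
    simp [S.nablaJ_app hZ, app_apply, inner_J_J]
  simp only [Pi.sub_apply, Pi.smul_apply] at h
  simp only [hermitianCurvature, riemannCurvature, curvature,
    S.curvatureOp_hermitianConnection hX (hX.app S.J) hZ, h]
  simp only [map_sub, map_smul, sub_apply, smul_apply, smul_eq_mul, h1, h2]
  rw [app_apply, inner_J_J]
  ring

lemma riemannCurvature_neg_right (hX : IsSmooth X) (hY : IsSmooth Y) (hZ : IsSmooth Z)
    (W : Π x : M, TangentSpace I x) (x : M) :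
    S.riemannCurvature X Y (-Z) W x = -S.riemannCurvature X Y Z W x := by
  simp [riemannCurvature, curvature,
    curvatureOp_neg_right (cov := leviCivita S.g) (fun h h' ↦ h.along_leviCivita S.g h')
      hX hY hZ]

/-- This is the preceding identity with $JZ$ in place of $Z$; it avoids having to prove that
$\widetilde R$ is skew in its last pair. -/
lemma hermitianCurvature_app_swap (hX : IsSmooth X) (hZ : IsSmooth Z) (x : M) :
    S.hermitianCurvature X (S.J.app X) (S.J.app Z) Z x
      = (1 / 2) * (S.riemannCurvature X (S.J.app X) (S.J.app Z) Z x
          - S.riemannCurvature X (S.J.app X) Z (S.J.app Z) x)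
        - (1 / 2) * S.g.inner x (S.nablaJ X Z x) (S.nablaJ X Z x) := by
  have h := S.hermitianCurvature_app hX (hZ.app S.J) x
  have neg4 (cov : CovariantDerivative I E (fun x : M ↦ TangentSpace I x))
      (A B C D : Π x : M, TangentSpace I x) :
      curvature S.g cov A B C (-D) x = -curvature S.g cov A B C D x := by
    simp [curvature]
  rw [app_app, S.riemannCurvature_neg_right hX (hX.app S.J) hZ] at h
  simp only [hermitianCurvature, riemannCurvature, neg4, S.nablaJ_app hZ, Pi.neg_apply, map_neg,
    neg_apply, neg_neg, app_apply, inner_J_J] at h ⊢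
  linarith

end AlmostKahlerStructure

end Curvature

end AlmostKahler

namespace AlmostKahler

/-! ### Comparison of the two curvatures and the Kähler condition -/

section Comparison

variable {E : Type*} [NormedAddCommGroup E] [NormedSpace ℝ E]
  [FiniteDimensional ℝ E] [CompleteSpace E]
  {H : Type*} [TopologicalSpace H] {I : ModelWithCorners ℝ E H}
  {M : Type*} [TopologicalSpace M] [ChartedSpace H M] [IsManifold I ∞ M]

/-- The field `X - i J X` of type `(1,0)`. -/
def AlmostComplexStructure.oneZero (J : AlmostComplexStructure I M) (X : Π x : M, TangentSpace I x)
    (hX : IsSmooth X) : ComplexVectorField I M where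
  re := X
  im := -J.app X
  smooth_re := hX
  smooth_im := (hX.app J).neg

lemma AlmostComplexStructure.isOneZero_oneZero (J : AlmostComplexStructure I M)
    {X : Π x : M, TangentSpace I x} (hX : IsSmooth X) : (J.oneZero X hX).IsOneZero J := by
  intro x
  simp [oneZero, app, J.sq]

lemma ComplexVectorField.isSmooth_part (Z : ComplexVectorField I M) (a : Fin 2) :
    IsSmooth (Z.part a) := by
  fin_cases a
  · exact Z.smooth_re
  · exact Z.smooth_im

lemma complexify_congr {T T' : (Π x : M, TangentSpace I x) → (Π x : M, TangentSpace I x) →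
      (Π x : M, TangentSpace I x) → (Π x : M, TangentSpace I x) → M → ℝ}
    (h : ∀ A B C D : Π x : M, TangentSpace I x, IsSmooth A → IsSmooth B → IsSmooth C →
      IsSmooth D → T A B C D = T' A B C D) (Z₁ Z₂ Z₃ Z₄ : ComplexVectorField I M) :
    complexify T Z₁ Z₂ Z₃ Z₄ = complexify T' Z₁ Z₂ Z₃ Z₄ := by
  funext x
  simp only [complexify, h _ _ _ _ (Z₁.isSmooth_part _) (Z₂.isSmooth_part _) (Z₃.isSmooth_part _)
    (Z₄.isSmooth_part _)]

/-- The real part of the curvature of a connection on `(Z, conj Z, W, conj W)`, where `Z` and `W`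
are the fields of type `(1,0)` with real parts `X` and `Y`. -/
lemma re_complexify_curvature (g : Metric I M)
    {cov : CovariantDerivative I E (fun x : M ↦ TangentSpace I x)}
    (hcov : ∀ {U V : Π x : M, TangentSpace I x}, IsSmooth U → IsSmooth V → IsSmooth (along cov U V))
    (J : AlmostComplexStructure I M) {X Y : Π x : M, TangentSpace I x}
    (hX : IsSmooth X) (hY : IsSmooth Y) (x : M) :
    (complexify (curvature g cov) (J.oneZero X hX) (J.oneZero X hX).conj
      (J.oneZero Y hY) (J.oneZero Y hY).conj x).re
      = 2 * (curvature g cov X (J.app X) (J.app Y) Y x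
        - curvature g cov X (J.app X) Y (J.app Y) x) := by
  have hJX := hX.app J
  have hJY := hY.app J
  have n1 {V W : Π x : M, TangentSpace I x} (hV : IsSmooth V) :=
    curvatureOp_neg_left hcov (Y := W) hJX hV x
  have n3 {V W : Π x : M, TangentSpace I x} (hV : IsSmooth V) (hW : IsSmooth W) :=
    curvatureOp_neg_right hcov hV hW hJY x
  have sw (V : Π x : M, TangentSpace I x) := curvatureOp_swap cov (X := X) (Y := J.app X) (Z := V) x
  -- Skewness in the first pair reduces $(Z,\overline Z)$ to $2i\,(X,JX)$. A second factor $i$, and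
  -- hence a real term, arises only from the mixed pairs $(Y,JY)$ and $(JY,Y)$.
  simp [complexify, ComplexVectorField.part, ComplexVectorField.conj,
    AlmostComplexStructure.oneZero, Fin.sum_univ_two, curvature, n1 hY, n1 hJY.neg, n3 hX hJX,
    n3 hX hX, n3 hJX hX, n3 hJX hJX, sw, curvatureOp_self, pow_succ]
  ring

namespace AlmostKahlerStructure

variable (S : AlmostKahlerStructure I M) {X Y : Π x : M, TangentSpace I x}

lemma nablaJ_eq_zero_of_inner_self
    (h : ∀ x, S.g.inner x (S.nablaJ X Y x) (S.nablaJ X Y x) = 0) : S.nablaJ X Y = 0 := by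
  funext x
  by_contra hne
  exact (S.g.pos x _ hne).ne' (h x)

variable {S}

/-- Skewness of $R$ in its last pair makes the averaged Riemann term equal to $R(X,JX,Y,JY)$, so the
hypothesis leaves $\tfrac12|(\nabla_XJ)Y|^2=0$. -/
lemma CurvaturesAgreeReal.nablaJ_eq_zero (h : S.CurvaturesAgreeReal) (hX : IsSmooth X)
    (hY : IsSmooth Y) : S.nablaJ X Y = 0 := by
  refine S.nablaJ_eq_zero_of_inner_self fun x ↦ ?_
  have h1 := h X Y hX hY x
  have h2 : S.riemannCurvature X (S.J.app X) (S.J.app Y) Y x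
      = -S.riemannCurvature X (S.J.app X) Y (S.J.app Y) x :=
    inner_curvatureOp_leviCivita_skew S.g hX (hX.app S.J) (hY.app S.J) hY x
  rw [S.hermitianCurvature_app hX hY, h2] at h1
  linarith

/-- The real part is a difference over the two orders of $(Y,JY)$, where the Riemann terms of
$\widetilde R$ and $R$ match. The quadratic terms have opposite signs in the two orders, so they add
up to a multiple of $|(\nabla_XJ)Y|^2$. -/
lemma CurvaturesAgreeComplex.nablaJ_eq_zero (h : S.CurvaturesAgreeComplex) (hX : IsSmooth X)
    (hY : IsSmooth Y) : S.nablaJ X Y = 0 := by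
  refine S.nablaJ_eq_zero_of_inner_self fun x ↦ ?_
  have h1 := congrArg Complex.re (h _ _ (S.J.isOneZero_oneZero hX) (S.J.isOneZero_oneZero hY) x)
  simp only [hermitianCurvature, riemannCurvature] at h1
  rw [re_complexify_curvature S.g (cov := S.hermitianConnection)
      (fun h h' ↦ h.along_hermitianConnection h'),
    re_complexify_curvature S.g (cov := leviCivita S.g) (fun h h' ↦ h.along_leviCivita S.g h')] at h1
  have h2 := S.hermitianCurvature_app hX hY x
  have h3 := S.hermitianCurvature_app_swap hX hY x
  simp only [hermitianCurvature, riemannCurvature] at h2 h3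
  linarith

/-- If `J` is parallel, then the Hermitian and Riemann curvature tensors agree. -/
lemma hermitianCurvature_eq_of_nablaJ_eq_zero
    (h : ∀ X Y : Π x : M, TangentSpace I x, IsSmooth X → IsSmooth Y → S.nablaJ X Y = 0)
    {X Y Z : Π x : M, TangentSpace I x} (W : Π x : M, TangentSpace I x)
    (hX : IsSmooth X) (hY : IsSmooth Y) (hZ : IsSmooth Z) :
    S.hermitianCurvature X Y Z W = S.riemannCurvature X Y Z W := by
  have key {U V : Π x : M, TangentSpace I x} (hU : IsSmooth U) (hV : IsSmooth V) :
      along S.hermitianConnection U V = along (leviCivita S.g) U V := by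
    rw [along_hermitianConnection, h U V hU hV]
    funext x
    simp [AlmostComplexStructure.app]
  funext x
  simp only [hermitianCurvature, riemannCurvature, curvature, curvatureOp_eq_along, key hY hZ,
    key hX hZ, key hX (hY.along_leviCivita S.g hZ), key hY (hX.along_leviCivita S.g hZ),
    key (hX.mlieBracket hY) hZ]

/-- If `J` is parallel, then it is integrable. -/
lemma isKahler_of_nablaJ_eq_zero
    (h : ∀ X Y : Π x : M, TangentSpace I x, IsSmooth X → IsSmooth Y → S.nablaJ X Y = 0) :
    S.IsKahler := by
  intro X Y hX hY x
  have hb {U V : Π x : M, TangentSpace I x} (hU : IsSmooth U) (hV : IsSmooth V) :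
      mlieBracket I U V x = along (leviCivita S.g) U V x - along (leviCivita S.g) V U x :=
    (leviCivita_torsion S.g (hU.mdifferentiableAt x) (hV.mdifferentiableAt x)).symm
  have hJX := hX.app S.J
  have hJY := hY.app S.J
  have ha {U V : Π x : M, TangentSpace I x} (hU : IsSmooth U) (hV : IsSmooth V) :
      along (leviCivita S.g) U (S.J.app V) x = S.J.toFun x (along (leviCivita S.g) U V x) := by
    rw [along_app, h U V hU hV, add_zero]
    rfl
  -- Each bracket becomes a difference of covariant derivatives; $J$ then passes through $\nabla$
  -- and the terms cancel in pairs by $J^2=-1$.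
  rw [AlmostComplexStructure.nijenhuis, hb hJX hJY, hb hJX hY, hb hX hJY, hb hX hY, ha hJX hY,
    ha hJY hX, ha hX hY, ha hY hX]
  simp only [map_sub, S.J.sq]
  abel

lemma curvaturesAgreeComplex_of_nablaJ_eq_zero
    (h : ∀ X Y : Π x : M, TangentSpace I x, IsSmooth X → IsSmooth Y → S.nablaJ X Y = 0) :
    S.CurvaturesAgreeComplex := by
  intro Z W _ _ x
  exact congrFun (complexify_congr
    (fun A B C D hA hB hC _ ↦ hermitianCurvature_eq_of_nablaJ_eq_zero h D hA hB hC) _ _ _ _) x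

lemma curvaturesAgreeReal_of_nablaJ_eq_zero
    (h : ∀ X Y : Π x : M, TangentSpace I x, IsSmooth X → IsSmooth Y → S.nablaJ X Y = 0) :
    S.CurvaturesAgreeReal := fun _ Y hX hY x ↦
  congrFun (hermitianCurvature_eq_of_nablaJ_eq_zero h (S.J.app Y) hX (hX.app S.J) hY) x

end AlmostKahlerStructure

end Comparison

end AlmostKahler

end

theorem theorem4p5 (n : ℕ) (M : Type*) [TopologicalSpace M] [T2Space M]
    [ChartedSpace (EuclideanSpace ℝ (Fin (2 * n))) M] [IsManifold (𝓡 (2 * n)) ∞ M]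
    (S : AlmostKahler.AlmostKahlerStructure (𝓡 (2 * n)) M) :
    (S.CurvaturesAgreeComplex ↔ S.CurvaturesAgreeReal) ∧
      (S.CurvaturesAgreeComplex → S.IsKahler) := by
  exact ⟨⟨fun h ↦ AlmostKahler.AlmostKahlerStructure.curvaturesAgreeReal_of_nablaJ_eq_zero
      fun _ _ hX hY ↦ h.nablaJ_eq_zero hX hY,
    fun h ↦ AlmostKahler.AlmostKahlerStructure.curvaturesAgreeComplex_of_nablaJ_eq_zero
      fun _ _ hX hY ↦ h.nablaJ_eq_zero hX hY⟩,
    fun h ↦ AlmostKahler.AlmostKahlerStructure.isKahler_of_nablaJ_eq_zero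
      fun _ _ hX hY ↦ h.nablaJ_eq_zero hX hY⟩
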